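/- **Setting.** Write $D(a,r)$ for the disk of center $a$ and radius $r$ in $\mathbb C$, and $\mathbb D=D(0,1)$. Let $(a_n)_{n\ge1}$ be points of $D(0,1/4)$ such that the terms of even index and the terms of odd index are both dense in that disk; let $(r_n)_{n\ge 1}$ be positive reals decreasing to $0$ with $r_n\le \frac1{10}$ and $\sum_{n\ge1} 2^{-n}|\log r_n|<\infty$; let $(m_n)_{n\ge1}$ be positive integers. Put $R_n=\prod_{k=1}^n r_k$, $M_n=\prod_{k=1}^n m_k$ (so $R_0=M_0=1$), $$\delta_0=\tfrac12,\qquad \delta_{n+1}=\frac{\delta_n^2\,r_{n+1}}{4m_{n+1}^2},\qquad \varepsilon_{n+1}=\frac{\delta_n^2}{2m_{n+1}^2},$$ and $A_n(z,w)=z-a_n$ for $n$ odd, $A_n(z,w)=z+\frac{w}{100}-a_n$ for $n$ even. Let $\mathcal S_0$ be a one-point set, $P_{0,s}(z,w)=w$, and inductively $$\Sigma_{n+1}=\overline D\Big(0,\delta_n\big(1-\tfrac1{m_{n+1}}\big)\Big)\cap \tfrac{3\delta_n}{m_{n+1}}\mathbb Z[i],\qquad \mathcal S_{n+1}=\mathcal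 S_n\times\Sigma_{n+1},$$ $$P_{n+1,(s,\sigma)}=(P_{n,s}-\sigma)^2-\varepsilon_{n+1}A_{n+1}.$$ Fix a vertical slice near the boundary, that is, a line $\{z+\gamma w=z_0\}$ with $\gamma, z_0\in\mathbb C$, $|\gamma|\le\frac1{100}$, such that $\frac38<|z_0-\gamma w|<\frac12$ for all $w\in\mathbb D$ (for instance, any $z_0$ with $\frac38+\frac1{100}\le|z_0|\le\frac12-\frac1{100}$). Use $w$ as coordinate on the slice, write $P_{n,s}(w)$ for $P_{n,s}(z_0-\gamma w,w)$ and $P_{n,s}'$ for its derivative in $w$, and let $X_{n,s}=\{w\in\mathbb D:\ |P_{n,s}(w)|<\delta_n\}$ be the trace on the slice of $\{|P_{n,s}|<\delta_n\}\subset D(0,\frac12)\times\mathbb D$. A univalent map is an injective holomorphic map; the distortion of a univalent map $f$ on $\Delta$ is $\sup_{w,w'\in\Delta}|f'(w)/f'(w')|$; and $\Delta$ has conformal radius $\rho$ seen from $p\in\Delta$ if there is a univalent map $f$ from $\Delta$ onto $\mathbb D$ with $f(p)=0$ and $|f'(p)|=1/\rho$. **Proposition.** There are universal constants $K,C>0$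 (independent of the sequences $(a_n),(r_n),(m_n)$, of the slice, and of $n$, $s$, $\Delta$) such that the following holds for every $n\ge 0$, every $s\in\mathcal S_n$ and every connected component $\Delta$ of $X_{n,s}$. Put $C_n=C^{n}$ if $n\ge1$ and $C_0=C$. 1. $\Delta$ is, up to uniformly bounded distortion, a disk of conformal radius comparable to $R_n/M_n$: there is $p\in\Delta$ with $P_{n,s}(p)=0$ such that the conformal radius $\rho$ of $\Delta$ seen from $p$ exists and satisfies $$C_n^{-1}\,\frac{R_n}{M_n}\le\rho\le C_n\,\frac{R_n}{M_n},$$ and there is a univalent map $f$ from $\Delta$ onto $D(0,\rho)$ with $f(p)=0$, $|f'(p)|=1$ and distortion at most $K$. 2. $P_{n,s}$ is a univalent map from $\Delta$ onto $D(0,\delta_n)$ of distortion at most $K$, and for every $w\in\Delta$ $$C_n^{-1}\,\delta_n\frac{M_n}{R_n}\le|P_{n,s}'(w)|\le C_n\,\delta_n\frac{M_n}{R_n}.$$ -/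

import Mathlib

open Set Filter Topology Metric

open scoped ENNReal

noncomputable section

namespace Wermer

/-- The free parameters of the construction: the points `a n`, the ramification parameters `r n`
and the subdivision parameters `m n`. All sequences are indexed by `n ≥ 1`; the values at `n = 0`
are never used. -/
structure Param where
  a : ℕ → ℂ
  r : ℕ → ℝ
  m : ℕ → ℕ
  a_mem : ∀ n, 1 ≤ n → a n ∈ ball (0 : ℂ) (1 / 4)
  even_dense : ball (0 : ℂ) (1 / 4) ⊆ closure (a '' {n | 1 ≤ n ∧ Even n})
  odd_dense : ball (0 : ℂ) (1 / 4) ⊆ closure (a '' {n | 1 ≤ n ∧ Odd n})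
  r_pos : ∀ n, 1 ≤ n → 0 < r n
  r_le : ∀ n, 1 ≤ n → r n ≤ 1 / 10
  r_anti : ∀ n, 1 ≤ n → r (n + 1) ≤ r n
  r_lim : Tendsto r atTop (𝓝 0)
  r_summable : Summable fun n : ℕ => |Real.log (r n)| / 2 ^ n
  m_pos : ∀ n, 1 ≤ n → 1 ≤ m n

namespace Param

variable (W : Param)

/-- `δ 0 = 1 / 2` and `δ (n + 1) = δ n ^ 2 * r (n + 1) / (4 * m (n + 1) ^ 2)`. -/
def delta : ℕ → ℝ
  | 0 => 1 / 2
  | n + 1 => delta n ^ 2 * W.r (n + 1) / (4 * (W.m (n + 1) : ℝ) ^ 2)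

/-- `ε (n + 1) = δ n ^ 2 / (2 * m (n + 1) ^ 2)`; the value `ε 0` is never used. -/
def eps : ℕ → ℝ
  | 0 => 0
  | n + 1 => W.delta n ^ 2 / (2 * (W.m (n + 1) : ℝ) ^ 2)

/-- The affine functions `A n`, for `n ≥ 1`. -/
def A (n : ℕ) (z w : ℂ) : ℂ :=
  if Odd n then z - W.a n else z + w / 100 - W.a n

/-- `centers n` is the set `Σ_{n+1}` of centers used to subdivide the disk of radius `δ n`:
the points of the lattice `(3 δ n / m (n + 1)) ℤ[i]` that lie in the closed disk of center `0` and
radius `δ n * (1 - 1 / m (n + 1))`. -/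
def centers (n : ℕ) : Set ℂ :=
  closedBall (0 : ℂ) (W.delta n * (1 - 1 / (W.m (n + 1) : ℝ))) ∩
    {σ | ∃ i j : ℤ, σ = ((3 * W.delta n / (W.m (n + 1) : ℝ) : ℝ) : ℂ) *
      ((i : ℂ) + (j : ℂ) * Complex.I)}

/-- The index sets: `S 0` is a singleton and `S (n + 1) = S n × Σ_{n+1}`. -/
def S : ℕ → Type
  | 0 => Unit
  | n + 1 => S n × W.centers n

/-- The polynomials `P_{n,s}`: `P_0 (z, w) = w` and
`P_{n+1,(s,σ)} = (P_{n,s} - σ) ^ 2 - ε_{n+1} A_{n+1}`. -/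
def P : (n : ℕ) → W.S n → ℂ → ℂ → ℂ
  | 0, _, _, w => w
  | n + 1, (s, σ), z, w => (P n s z w - (σ : ℂ)) ^ 2 - (W.eps (n + 1) : ℂ) * W.A (n + 1) z w

/-- `X_{n,s} = {|P_{n,s}| < δ n}` in the bidisk `D(0, 1/2) × D(0, 1)`. -/
def X (n : ℕ) (s : W.S n) : Set (ℂ × ℂ) :=
  {p | p ∈ ball (0 : ℂ) (1 / 2) ×ˢ ball (0 : ℂ) 1 ∧ ‖W.P n s p.1 p.2‖ < W.delta n}

/-- The restriction of `P_{n,s}` to the line `z + γ w = z₀`, in the coordinate `w`. -/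
def sliceP (γ z₀ : ℂ) (n : ℕ) (s : W.S n) (w : ℂ) : ℂ :=
  W.P n s (z₀ - γ * w) w

/-- The trace of `X_{n,s}` on the line `z + γ w = z₀`, in the coordinate `w`. -/
def sliceX (γ z₀ : ℂ) (n : ℕ) (s : W.S n) : Set ℂ :=
  {w | (z₀ - γ * w, w) ∈ W.X n s}

/-- `R_n = r_1 ⋯ r_n`. -/
def R (n : ℕ) : ℝ := ∏ k ∈ Finset.Icc 1 n, W.r k

/-- `M_n = m_1 ⋯ m_n`. -/
def M (n : ℕ) : ℝ := ∏ k ∈ Finset.Icc 1 n, (W.m k : ℝ)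

end Param

/-- The line `z + γ w = z₀` is a vertical slice near the boundary: it is almost vertical, and over
the unit disk it is a graph with values in `{3/8 < |z| < 1/2}`. -/
def IsVerticalSlice (γ z₀ : ℂ) : Prop :=
  ‖γ‖ ≤ 1 / 100 ∧ ∀ w ∈ ball (0 : ℂ) 1, 3 / 8 < ‖z₀ - γ * w‖ ∧ ‖z₀ - γ * w‖ < 1 / 2

/-- A sufficient explicit condition, satisfied in particular when `‖z₀‖ = 2 / 5`. -/
theorem isVerticalSlice_of_norm {γ z₀ : ℂ} (hγ : ‖γ‖ ≤ 1 / 100)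
    (h₁ : 3 / 8 + 1 / 100 ≤ ‖z₀‖) (h₂ : ‖z₀‖ ≤ 1 / 2 - 1 / 100) : IsVerticalSlice γ z₀ := by
  refine ⟨hγ, fun w hw => ?_⟩
  have hw1 : ‖w‖ < 1 := by simpa using hw
  have h : ‖γ * w‖ < 1 / 100 := by
    rw [norm_mul]
    nlinarith [norm_nonneg γ, norm_nonneg w]
  have h3 := norm_sub_norm_le z₀ (γ * w)
  have h4 := norm_sub_le z₀ (γ * w)
  constructor <;> linarith

/-- `Δ` is a connected component of `U`. -/
def IsComponent (Δ U : Set ℂ) : Prop :=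
  ∃ x ∈ U, Δ = connectedComponentIn U x

/-- `f` is a univalent (holomorphic and injective) map from `U` onto `V`. -/
def IsUnivalentOnto (f : ℂ → ℂ) (U V : Set ℂ) : Prop :=
  DifferentiableOn ℂ f U ∧ BijOn f U V

/-- The distortion `sup_{z, w ∈ U} |f'(z) / f'(w)|`. -/
def distortion (f : ℂ → ℂ) (U : Set ℂ) : ℝ≥0∞ :=
  ⨆ z ∈ U, ⨆ w ∈ U, ‖deriv f z‖ₑ / ‖deriv f w‖ₑ

/-- The topological disk `Δ` has conformal radius `ρ`, seen from the point `p`: there is a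
conformal map `f` from `Δ` onto the unit disk with `f p = 0` and `|f'(p)| = 1 / ρ`. -/
def HasConformalRadius (Δ : Set ℂ) (p : ℂ) (ρ : ℝ) : Prop :=
  0 < ρ ∧ p ∈ Δ ∧ ∃ f : ℂ → ℂ, IsUnivalentOnto f Δ (ball 0 1) ∧ f p = 0 ∧ ‖deriv f p‖ = 1 / ρ

/-- `x ≈ y` at rank `n` with constant `C`: for `n ≥ 1` this reads `x / C ^ n ≤ y ≤ C ^ n * x`;
for `n = 0` the factor is `C` instead of `C ^ 0`. -/
def Approx (C : ℝ) (n : ℕ) (x y : ℝ) : Prop :=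
  x / C ^ max n 1 ≤ y ∧ y ≤ C ^ max n 1 * x

end Wermer

end

/-!
On the slice, the step from `P` to `Q = (P - σ) ^ 2 - ε A` multiplies the size of the derivative by
`2 |P - σ|`: the function `A` is almost constant on the slice and bounded away from `0` there, so on
the part of the disk where `Q` is small `P - σ` stays in a neighbourhood of two opposite square
roots of `ε A`, at distance comparable to `ε ^ (1 / 2)` from `0`, whereas `ε A'` is negligible. By
induction this gives the estimate of the derivative. On a connected piece, `P - σ` stays near one of
the two square roots, so that `Q x - Q y ≈ (P x + P y - 2 σ) (P x - P y)` is an expansion whenever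
`P` is, and `Q` is injective.

The distortion remains bounded because `δ |P''| ≤ |P'| ^ 2` also passes from one rank to the next:
in terms of the inverse `g` of `P`, it says that `|d/dv log P' (g v)| ≤ 1 / δ` on the disk of radius
`δ`, hence `P'` varies at most by the factor `exp 2`.
-/

namespace Wermer

section General

theorem norm_le_exp_mul_norm_of_hasFDerivWithinAt {E F : Type*} [NormedAddCommGroup E]
    [NormedSpace ℝ E] [NormedAddCommGroup F] [NormedSpace ℝ F] {h : E → F} {h' : E → E →L[ℝ] F}
    {V : Set E} {L : ℝ} (hV : Convex ℝ V) (hh : ∀ v ∈ V, HasFDerivWithinAt h (h' v) V v)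
    (hL : ∀ v ∈ V, ‖h' v‖ ≤ L * ‖h v‖) {u v : E} (hu : u ∈ V) (hv : v ∈ V) :
    ‖h v‖ ≤ Real.exp (L * ‖v - u‖) * ‖h u‖ := by
  set γ : ℝ → E := ⇑(AffineMap.lineMap (k := ℝ) u v)
  have hγ : MapsTo γ (Icc 0 1) V := hV.mapsTo_lineMap hu hv
  have hderiv : ∀ t ∈ Icc (0 : ℝ) 1,
      HasDerivWithinAt (h ∘ γ) (h' (γ t) (v - u)) (Icc 0 1) t := fun t ht =>
    (hh _ (hγ ht)).comp_hasDerivWithinAt t AffineMap.hasDerivWithinAt_lineMap hγ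
  have hbound : ∀ t ∈ Ico (0 : ℝ) 1,
      ‖h' (γ t) (v - u)‖ ≤ L * ‖v - u‖ * ‖(h ∘ γ) t‖ + 0 := fun t ht => by
    calc ‖h' (γ t) (v - u)‖ ≤ ‖h' (γ t)‖ * ‖v - u‖ := (h' (γ t)).le_opNorm _
      _ ≤ L * ‖h (γ t)‖ * ‖v - u‖ := by
          gcongr
          exact hL _ (hγ (Ico_subset_Icc_self ht))
      _ = L * ‖v - u‖ * ‖(h ∘ γ) t‖ + 0 := by simp only [Function.comp_apply]; ring
  have hgronwall := norm_le_gronwallBound_of_norm_deriv_right_le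
    (fun t ht => (hderiv t ht).continuousWithinAt)
    (fun t ht => (hderiv t (Ico_subset_Icc_self ht)).mono_of_mem_nhdsWithin
      (Icc_mem_nhdsGE_of_mem ht))
    le_rfl hbound 1 (right_mem_Icc.2 zero_le_one)
  simpa [γ, gronwallBound_ε0, mul_comm] using hgronwall

theorem surjOn_of_closure_inter_preimage_subset {X Y : Type*} [TopologicalSpace X]
    [TopologicalSpace Y] [T2Space Y] {f : X → Y} {U : Set X} {V : Set Y} (hU : U.Nonempty)
    (hcompact : IsCompact (closure U)) (hf : ContinuousOn f (closure U)) (hmaps : MapsTo f U V)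
    (hopen : IsOpen (f '' U)) (hV : IsPreconnected V) (hclosed : closure U ∩ f ⁻¹' V ⊆ U) :
    SurjOn f U V := by
  obtain ⟨x, hx⟩ := hU
  refine hV.subset_of_closure_inter_subset hopen ⟨f x, hmaps hx, mem_image_of_mem f hx⟩ ?_
  rintro y ⟨hy, hyV⟩
  obtain ⟨z, hz, rfl⟩ : y ∈ f '' closure U :=
    closure_minimal (image_mono subset_closure) (hcompact.image_of_continuousOn hf).isClosed hy
  exact mem_image_of_mem f (hclosed ⟨hz, hyV⟩)

theorem isOpen_image_of_deriv_ne_zero {f : ℂ → ℂ} {U : Set ℂ} (hU : IsOpen U)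
    (hf : DifferentiableOn ℂ f U) (hf' : ∀ w ∈ U, deriv f w ≠ 0) : IsOpen (f '' U) := by
  refine isOpen_iff_mem_nhds.2 ?_
  rintro _ ⟨w, hw, rfl⟩
  rw [← (hf.analyticAt (hU.mem_nhds hw)).hasStrictDerivAt.map_nhds_eq (hf' w hw)]
  exact image_mem_map (hU.mem_nhds hw)

theorem le_mul_of_le_sq_of_isPreconnected {X : Type*} [TopologicalSpace X] {T : Set X}
    (hT : IsPreconnected T) {u : X → ℝ} (hu : ContinuousOn u T) {s : ℝ} (hs : 0 < s)
    (h : ∀ w ∈ T, s ≤ u w ^ 2) {x y : X} (hx : x ∈ T) (hy : y ∈ T) : s ≤ u x * u y := by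
  have habs_ne : ∀ {w}, w ∈ T → |u w| ≠ 0 := fun hw hzero => by
    have := h _ hw
    rw [abs_eq_zero.1 hzero] at this
    linarith
  have hnonneg : 0 ≤ u x * u y := by
    rcases hT.eq_or_eq_neg_of_sq_eq hu hu.abs (fun w _ => (sq_abs (u w)).symm) habs_ne
      with heq | heq
    · rw [heq hx, heq hy]
      positivity
    · rw [heq hx, heq hy, Pi.neg_apply, Pi.neg_apply, neg_mul_neg]
      positivity
  refine le_of_sq_le_sq ?_ hnonneg
  rw [mul_pow, sq s]
  exact mul_le_mul (h x hx) (h y hy) hs.le (sq_nonneg _)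

theorem one_sub_norm_sq_sub_one_le_sq_re (q : ℂ) : 1 - ‖q ^ 2 - 1‖ ≤ q.re ^ 2 := by
  have hre : (q ^ 2 - 1).re = q.re ^ 2 - q.im ^ 2 - 1 := by simp [sq]
  have := (abs_le.1 (Complex.abs_re_le_norm (q ^ 2 - 1))).1
  linarith [sq_nonneg q.im]

theorem four_mul_sub_le_sq_norm_add_of_isPreconnected {X : Type*} [TopologicalSpace X] {T : Set X}
    (hT : IsPreconnected T) {f : X → ℂ} (hf : ContinuousOn f T) {a : ℂ} {t : ℝ}
    (h : ∀ w ∈ T, ‖f w ^ 2 - a‖ ≤ t) {x y : X} (hx : x ∈ T) (hy : y ∈ T) :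
    4 * (‖a‖ - t) ≤ ‖f x + f y‖ ^ 2 := by
  rcases le_or_gt ‖a‖ t with hat | hta
  · exact (by linarith : 4 * (‖a‖ - t) ≤ 0).trans (sq_nonneg _)
  have ha : 0 < ‖a‖ := ((norm_nonneg _).trans (h x hx)).trans_lt hta
  obtain ⟨c, rfl⟩ := IsAlgClosed.exists_pow_nat_eq a two_pos
  have hc : c ≠ 0 := by rintro rfl; simp at ha
  have hre : ∀ w ∈ T, 1 - t / ‖c ^ 2‖ ≤ (f w / c).re ^ 2 := fun w hw => by
    refine le_trans ?_ (one_sub_norm_sq_sub_one_le_sq_re _)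
    rw [div_pow, div_sub_one (pow_ne_zero 2 hc), norm_div]
    gcongr
    exact h w hw
  have hmul : 1 - t / ‖c ^ 2‖ ≤ (f x / c).re * (f y / c).re :=
    le_mul_of_le_sq_of_isPreconnected hT (Complex.continuous_re.comp_continuousOn (hf.div_const c))
      (sub_pos.2 ((div_lt_one ha).2 hta)) hre hx hy
  calc 4 * (‖c ^ 2‖ - t) = ‖c ^ 2‖ * (4 * (1 - t / ‖c ^ 2‖)) := by field_simp
    _ ≤ ‖c ^ 2‖ * ((f x + f y) / c).re ^ 2 := by
        gcongr
        rw [add_div, Complex.add_re]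
        linarith [hre x hx, hre y hy]
    _ ≤ ‖c ^ 2‖ * ‖(f x + f y) / c‖ ^ 2 := by
        rw [← sq_abs (Complex.re _)]
        gcongr
        exact Complex.abs_re_le_norm _
    _ = ‖f x + f y‖ ^ 2 := by
        rw [norm_pow, norm_div, div_pow]
        field_simp

end General

namespace IsComponent

variable {Δ U : Set ℂ}

theorem isPreconnected (h : IsComponent Δ U) : IsPreconnected Δ := by
  obtain ⟨x, -, rfl⟩ := h
  exact isPreconnected_connectedComponentIn

theorem subset (h : IsComponent Δ U) : Δ ⊆ U := by
  obtain ⟨x, -, rfl⟩ := h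
  exact connectedComponentIn_subset U x

theorem nonempty (h : IsComponent Δ U) : Δ.Nonempty := by
  obtain ⟨x, hx, rfl⟩ := h
  exact ⟨x, mem_connectedComponentIn hx⟩

theorem isOpen (h : IsComponent Δ U) (hU : IsOpen U) : IsOpen Δ := by
  obtain ⟨x, -, rfl⟩ := h
  exact hU.connectedComponentIn

theorem closure_inter_subset (h : IsComponent Δ U) : closure Δ ∩ U ⊆ Δ := by
  have hpreconnected : IsPreconnected (closure Δ ∩ U) := h.isPreconnected.subset_closure
    (subset_inter subset_closure h.subset) inter_subset_left
  obtain ⟨x, hx, rfl⟩ := h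
  exact hpreconnected.subset_connectedComponentIn
    ⟨subset_closure (mem_connectedComponentIn hx), hx⟩ inter_subset_right

end IsComponent

theorem distortion_le_ofReal {f : ℂ → ℂ} {U : Set ℂ} {K : ℝ} (hK : 0 ≤ K)
    (h : ∀ z ∈ U, ∀ w ∈ U, ‖deriv f z‖ ≤ K * ‖deriv f w‖) :
    distortion f U ≤ ENNReal.ofReal K := by
  refine iSup₂_le fun z hz => iSup₂_le fun w hw => ENNReal.div_le_of_le_mul ?_
  rw [← ofReal_norm, ← ofReal_norm, ← ENNReal.ofReal_mul hK]
  exact ENNReal.ofReal_le_ofReal (h z hz w hw)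

theorem distortion_const_mul {c : ℂ} (hc : c ≠ 0) (f : ℂ → ℂ) (U : Set ℂ) :
    distortion (fun w => c * f w) U = distortion f U := by
  simp only [distortion, deriv_const_mul_field, enorm_mul,
    ENNReal.mul_div_mul_left _ _ (enorm_ne_zero.2 hc) enorm_ne_top]

namespace IsUnivalentOnto

variable {f : ℂ → ℂ} {U V : Set ℂ}

theorem const_mul_ball {δ : ℝ} (hf : IsUnivalentOnto f U (ball 0 δ)) {c : ℂ} (hc : c ≠ 0) :
    IsUnivalentOnto (fun w => c * f w) U (ball 0 (‖c‖ * δ)) := by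
  have himage : (fun v => c * v) '' ball 0 δ = ball 0 (‖c‖ * δ) :=
    (smul_ball hc 0 δ).trans (by rw [smul_zero])
  refine ⟨hf.1.const_mul c, ?_⟩
  rw [← himage]
  exact (mul_right_injective₀ hc).injOn.bijOn_image.comp hf.2

theorem hasDerivAt_invFunOn (hf : IsUnivalentOnto f U V) (hU : IsOpen U) {w : ℂ} (hw : w ∈ U)
    (hf' : deriv f w ≠ 0) : HasDerivAt (Function.invFunOn f U) (deriv f w)⁻¹ (f w) := by
  refine ((hf.1.analyticAt (hU.mem_nhds hw)).hasStrictDerivAt.to_local_left_inverse hf'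
    ?_).hasDerivAt
  filter_upwards [hU.mem_nhds hw] with z hz using hf.2.injOn.leftInvOn_invFunOn hz

theorem norm_deriv_le (hf : IsUnivalentOnto f U V) (hU : IsOpen U) (hV : Convex ℝ V)
    (hf' : ∀ w ∈ U, deriv f w ≠ 0) {L : ℝ}
    (hL : ∀ w ∈ U, ‖deriv (deriv f) w‖ ≤ L * ‖deriv f w‖ ^ 2) {x y : ℂ} (hx : x ∈ U)
    (hy : y ∈ U) : ‖deriv f y‖ ≤ Real.exp (L * ‖f y - f x‖) * ‖deriv f x‖ := by
  set g := Function.invFunOn f U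
  have hgf : ∀ w ∈ U, g (f w) = w := fun w hw => hf.2.injOn.leftInvOn_invFunOn hw
  have hderiv : ∀ w ∈ U, HasDerivAt (deriv f ∘ g)
      (deriv (deriv f) w * (deriv f w)⁻¹) (f w) := fun w hw => by
    have hff := ((hf.1.deriv hU).differentiableAt (hU.mem_nhds hw)).hasDerivAt
    exact hff.comp_of_eq (f w) (hf.hasDerivAt_invFunOn hU hw (hf' w hw)) (hgf w hw).symm
  have hfderiv : ∀ v ∈ V, HasFDerivWithinAt (deriv f ∘ g)
      ((deriv (deriv f) (g v) * (deriv f (g v))⁻¹) • (1 : ℂ →L[ℝ] ℂ)) V v := by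
    intro v hv
    obtain ⟨w, hw, rfl⟩ := hf.2.surjOn hv
    rw [hgf w hw]
    exact (hderiv w hw).complexToReal_fderiv.hasFDerivWithinAt
  have hbound : ∀ v ∈ V, ‖(deriv (deriv f) (g v) * (deriv f (g v))⁻¹) • (1 : ℂ →L[ℝ] ℂ)‖ ≤
      L * ‖(deriv f ∘ g) v‖ := by
    intro v hv
    obtain ⟨w, hw, rfl⟩ := hf.2.surjOn hv
    have hpos : 0 < ‖deriv f w‖ := norm_pos_iff.2 (hf' w hw)
    rw [Function.comp_apply, hgf w hw, norm_smul, norm_one, mul_one, norm_mul, norm_inv,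
      mul_inv_le_iff₀ hpos, mul_assoc, ← sq]
    exact hL w hw
  have hexp := norm_le_exp_mul_norm_of_hasFDerivWithinAt hV hfderiv hbound
    (hf.2.mapsTo hx) (hf.2.mapsTo hy)
  rwa [Function.comp_apply, Function.comp_apply, hgf x hx, hgf y hy] at hexp

theorem distortion_le {δ : ℝ} (hf : IsUnivalentOnto f U (ball 0 δ)) (hU : IsOpen U)
    (hf' : ∀ w ∈ U, deriv f w ≠ 0)
    (hff' : ∀ w ∈ U, δ * ‖deriv (deriv f) w‖ ≤ ‖deriv f w‖ ^ 2) :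
    distortion f U ≤ ENNReal.ofReal (Real.exp 2) := by
  refine distortion_le_ofReal (Real.exp_pos 2).le fun y hy x hx => ?_
  have hfy := mem_ball_zero_iff.1 (hf.2.mapsTo hy)
  have hfx := mem_ball_zero_iff.1 (hf.2.mapsTo hx)
  have hδ : 0 < δ := (norm_nonneg _).trans_lt hfx
  have hL : ∀ w ∈ U, ‖deriv (deriv f) w‖ ≤ δ⁻¹ * ‖deriv f w‖ ^ 2 := fun w hw =>
    (le_inv_mul_iff₀ hδ).2 (hff' w hw)
  refine (hf.norm_deriv_le hU (convex_ball 0 δ) hf' hL hx hy).trans ?_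
  gcongr
  rw [inv_mul_le_iff₀ hδ]
  linarith [norm_sub_le (f y) (f x)]

variable {δ : ℝ} {p : ℂ}

theorem hasConformalRadius (hf : IsUnivalentOnto f U (ball 0 δ)) (hδ : 0 < δ) (hp : p ∈ U)
    (hfp : f p = 0) (hf' : deriv f p ≠ 0) : HasConformalRadius U p (δ / ‖deriv f p‖) := by
  have hnorm : ‖(δ : ℂ)⁻¹‖ = δ⁻¹ := by
    rw [norm_inv, Complex.norm_real, Real.norm_of_nonneg hδ.le]
  have hδc : (δ : ℂ)⁻¹ ≠ 0 := inv_ne_zero (Complex.ofReal_ne_zero.2 hδ.ne')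
  refine ⟨div_pos hδ (norm_pos_iff.2 hf'), hp, fun w => (δ : ℂ)⁻¹ * f w, ?_, ?_, ?_⟩
  · simpa only [hnorm, inv_mul_cancel₀ hδ.ne'] using hf.const_mul_ball hδc
  · simp only [hfp, mul_zero]
  · rw [deriv_const_mul_field, norm_mul, hnorm, one_div_div, inv_mul_eq_div]

theorem exists_norm_deriv_eq_one (hf : IsUnivalentOnto f U (ball 0 δ)) (hfp : f p = 0)
    (hf' : deriv f p ≠ 0) :
    ∃ g : ℂ → ℂ, IsUnivalentOnto g U (ball 0 (δ / ‖deriv f p‖)) ∧ g p = 0 ∧ ‖deriv g p‖ = 1 ∧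
      distortion g U = distortion f U := by
  refine ⟨fun w => (deriv f p)⁻¹ * f w, ?_, ?_, ?_, distortion_const_mul (inv_ne_zero hf') f U⟩
  · simpa only [norm_inv, inv_mul_eq_div] using hf.const_mul_ball (inv_ne_zero hf')
  · simp only [hfp, mul_zero]
  · rw [deriv_const_mul_field, inv_mul_cancel₀ hf', norm_one]

end IsUnivalentOnto

theorem Approx.of_le {C D : ℝ} (hC : 1 ≤ C) (hD : 1 ≤ D) {n : ℕ} {x y : ℝ} (hx : 0 ≤ x)
    (hxy : x ≤ y) (hyx : y ≤ C * D ^ n * x) : Approx (C * D) n x y := by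
  have hconst : C * D ^ n ≤ (C * D) ^ max n 1 := by
    rw [mul_pow]
    gcongr
    · exact le_self_pow₀ hC (by omega)
    · exact le_max_left n 1
  have hone : 1 ≤ C * D := one_le_mul_of_one_le_of_one_le hC hD
  exact ⟨(div_le_self hx (one_le_pow₀ hone)).trans hxy, hyx.trans (by gcongr)⟩

theorem Approx.const_div {C : ℝ} {n : ℕ} {x y d : ℝ} (hC : 0 < C) (hx : 0 < x) (hy : 0 < y)
    (hd : 0 ≤ d) (h : Approx C n x y) : Approx C n (d / x) (d / y) := by
  obtain ⟨hxy, hyx⟩ := h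
  constructor
  · rw [div_div, mul_comm]
    gcongr
  · calc d / y ≤ d / (x / C ^ max n 1) := by gcongr
      _ = C ^ max n 1 * (d / x) := by field_simp

/-- The set `{w ∈ 𝔻 : |P w| < δ}`; the traces `X_{n,s}` are of this form. -/
def sublevel (P : ℂ → ℂ) (δ : ℝ) : Set ℂ :=
  ball 0 1 ∩ P ⁻¹' ball 0 δ

theorem mem_sublevel {P : ℂ → ℂ} {δ : ℝ} {w : ℂ} :
    w ∈ sublevel P δ ↔ ‖w‖ < 1 ∧ ‖P w‖ < δ := by
  simp only [sublevel, mem_inter_iff, mem_preimage, mem_ball_zero_iff]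

theorem isOpen_sublevel {P : ℂ → ℂ} (hP : Continuous P) (δ : ℝ) : IsOpen (sublevel P δ) :=
  isOpen_ball.inter (isOpen_ball.preimage hP)

/-- The data of one step of the construction on a slice, from the level `δ = δ_n` to the level
`δ' = δ_{n+1}`. Here `center` is `σ`, `mesh` is `δ_n / m_{n+1}`, so that `ε_{n+1} = mesh ^ 2 / 2`
and `δ_{n+1} = mesh ^ 2 * r_{n+1} / 4`, and `offset + slope * w` is the restriction of `A_{n+1}` to
the slice. The numbers `r_{n+1}` and `m_{n+1}` only enter through `δ`, `δ'` and `mesh`. -/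
structure QuadraticStep (δ δ' : ℝ) where
  mesh : ℝ
  center : ℂ
  offset : ℂ
  slope : ℂ
  mesh_pos : 0 < mesh
  norm_center_le : ‖center‖ ≤ δ - mesh
  level_pos : 0 < δ'
  level_le : δ' ≤ mesh ^ 2 / 40
  le_norm_offset : 1 / 8 ≤ ‖offset‖
  norm_offset_le : ‖offset‖ ≤ 3 / 4
  norm_slope_le : ‖slope‖ ≤ 1 / 50

namespace QuadraticStep

variable {δ δ' : ℝ} (T : QuadraticStep δ δ') {P : ℂ → ℂ} {w : ℂ}

/-- The parameter `ε_{n+1}` of the step. -/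
noncomputable def eps : ℝ := T.mesh ^ 2 / 2

/-- The function `(P - σ) ^ 2 - ε A` obtained from `P` by the step. -/
noncomputable def apply (P : ℂ → ℂ) (w : ℂ) : ℂ :=
  (P w - T.center) ^ 2 - T.eps * (T.offset + T.slope * w)

theorem eps_pos : 0 < T.eps :=
  half_pos (pow_pos T.mesh_pos 2)

theorem mesh_le : T.mesh ≤ δ := by
  linarith [T.norm_center_le, norm_nonneg T.center]

theorem norm_eps_mul (z : ℂ) : ‖(T.eps : ℂ) * z‖ = T.mesh ^ 2 / 2 * ‖z‖ := by
  rw [norm_mul, Complex.norm_real, Real.norm_of_nonneg T.eps_pos.le, eps]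

theorem hasDerivAt_apply {P' : ℂ} (hP : HasDerivAt P P' w) :
    HasDerivAt (T.apply P) (2 * (P w - T.center) * P' - T.eps * T.slope) w := by
  have haffine : HasDerivAt (fun w => T.offset + T.slope * w) T.slope w := by
    simpa using ((hasDerivAt_id w).const_mul T.slope).const_add T.offset
  refine (((hP.sub_const T.center).pow 2).sub (haffine.const_mul (T.eps : ℂ))).congr_deriv ?_
  norm_num

theorem differentiable_apply (hP : Differentiable ℂ P) : Differentiable ℂ (T.apply P) :=
  fun w => (T.hasDerivAt_apply (hP w).hasDerivAt).differentiableAt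

theorem deriv_apply (hP : Differentiable ℂ P) :
    deriv (T.apply P) = fun w => 2 * (P w - T.center) * deriv P w - T.eps * T.slope :=
  funext fun w => (T.hasDerivAt_apply (hP w).hasDerivAt).deriv

theorem deriv_deriv_apply (hP : Differentiable ℂ P) (w : ℂ) :
    deriv (deriv (T.apply P)) w =
      2 * (deriv P w ^ 2 + (P w - T.center) * deriv (deriv P) w) := by
  have hP' := ((hP.differentiableOn.deriv isOpen_univ).differentiableAt univ_mem).hasDerivAt
    (x := w)
  have h := ((((hP w).hasDerivAt.sub_const T.center).const_mul 2).mul hP').sub_const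
    ((T.eps : ℂ) * T.slope)
  rw [T.deriv_apply hP]
  exact h.deriv.trans (by ring)

theorem norm_sq_sub_le (hw : w ∈ sublevel (T.apply P) δ') :
    ‖(P w - T.center) ^ 2 - T.eps * T.offset‖ ≤ 7 / 200 * T.mesh ^ 2 := by
  obtain ⟨hw1, hwδ⟩ := mem_sublevel.1 hw
  have hslope : ‖(T.eps : ℂ) * (T.slope * w)‖ ≤ T.mesh ^ 2 / 2 * (1 / 50 * 1) := by
    rw [norm_eps_mul, norm_mul]
    gcongr
    exact T.norm_slope_le
  calc ‖(P w - T.center) ^ 2 - T.eps * T.offset‖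
      = ‖T.apply P w + T.eps * (T.slope * w)‖ := by rw [apply]; ring_nf
    _ ≤ ‖T.apply P w‖ + ‖(T.eps : ℂ) * (T.slope * w)‖ := norm_add_le _ _
    _ ≤ 7 / 200 * T.mesh ^ 2 := by linarith [T.level_le]

theorem mul_mesh_le_norm_add {S : Set ℂ} (hS : IsPreconnected S) (hP : Continuous P)
    (hSX : S ⊆ sublevel (T.apply P) δ') {x y : ℂ} (hx : x ∈ S) (hy : y ∈ S) :
    8 / 25 * T.mesh ≤ ‖(P x - T.center) + (P y - T.center)‖ := by
  have hsq : 4 * (‖(T.eps : ℂ) * T.offset‖ - 7 / 200 * T.mesh ^ 2) ≤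
      ‖(P x - T.center) + (P y - T.center)‖ ^ 2 :=
    four_mul_sub_le_sq_norm_add_of_isPreconnected hS
      (hP.sub continuous_const).continuousOn (fun w hw => T.norm_sq_sub_le (hSX hw)) hx hy
  rw [norm_eps_mul] at hsq
  refine le_of_sq_le_sq ?_ (norm_nonneg _)
  nlinarith [T.le_norm_offset, sq_nonneg T.mesh]

theorem le_norm_sub_center (hw : w ∈ sublevel (T.apply P) δ') :
    4 / 25 * T.mesh ≤ ‖P w - T.center‖ := by
  have hoffset := norm_sub_norm_le ((T.eps : ℂ) * T.offset) ((P w - T.center) ^ 2)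
  rw [norm_sub_rev, norm_eps_mul, norm_pow] at hoffset
  refine le_of_sq_le_sq ?_ (norm_nonneg _)
  nlinarith [T.norm_sq_sub_le hw, T.le_norm_offset, sq_nonneg T.mesh]

theorem norm_sub_center_le (hw : w ∈ sublevel (T.apply P) δ') :
    ‖P w - T.center‖ ≤ 2 / 3 * T.mesh := by
  have hoffset := norm_sub_norm_le ((P w - T.center) ^ 2) ((T.eps : ℂ) * T.offset)
  rw [norm_eps_mul, norm_pow] at hoffset
  refine le_of_sq_le_sq ?_ (mul_nonneg (by norm_num) T.mesh_pos.le)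
  nlinarith [T.norm_sq_sub_le hw, T.norm_offset_le, sq_nonneg T.mesh]

theorem sublevel_apply_subset (P : ℂ → ℂ) : sublevel (T.apply P) δ' ⊆ sublevel P δ := by
  intro w hw
  refine mem_sublevel.2 ⟨(mem_sublevel.1 hw).1, ?_⟩
  linarith [norm_sub_norm_le (P w) T.center, T.norm_sub_center_le hw, T.norm_center_le, T.mesh_pos]

theorem norm_eps_mul_slope_le : ‖(T.eps : ℂ) * T.slope‖ ≤ T.mesh ^ 2 / 100 := by
  rw [norm_eps_mul]
  nlinarith [T.norm_slope_le, sq_nonneg T.mesh]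

theorem norm_eps_mul_slope_le_of_le {d : ℝ} (hd : 2 * δ ≤ d) :
    ‖(T.eps : ℂ) * T.slope‖ ≤ 1 / 200 * (T.mesh * d) := by
  nlinarith [T.norm_eps_mul_slope_le, T.mesh_pos, T.mesh_le]

theorem norm_two_mul_sub_center_mul (z : ℂ) (w : ℂ) :
    ‖2 * (P w - T.center) * z‖ = 2 * ‖P w - T.center‖ * ‖z‖ := by
  rw [norm_mul, norm_mul, Complex.norm_two]

theorem le_norm_deriv_apply (hP : Differentiable ℂ P) (hw : w ∈ sublevel (T.apply P) δ')
    (hd : 2 * δ ≤ ‖deriv P w‖) :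
    3 / 10 * (T.mesh * ‖deriv P w‖) ≤ ‖deriv (T.apply P) w‖ := by
  rw [T.deriv_apply hP]
  refine le_trans ?_ (norm_sub_norm_le _ _)
  rw [norm_two_mul_sub_center_mul]
  nlinarith [T.le_norm_sub_center hw, T.norm_eps_mul_slope_le_of_le hd, T.mesh_pos,
    norm_nonneg (deriv P w)]

theorem norm_deriv_apply_le (hP : Differentiable ℂ P) (hw : w ∈ sublevel (T.apply P) δ')
    (hd : 2 * δ ≤ ‖deriv P w‖) :
    ‖deriv (T.apply P) w‖ ≤ 3 / 2 * (T.mesh * ‖deriv P w‖) := by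
  rw [T.deriv_apply hP]
  refine (norm_sub_le _ _).trans ?_
  rw [norm_two_mul_sub_center_mul]
  nlinarith [T.norm_sub_center_le hw, T.norm_eps_mul_slope_le_of_le hd, T.mesh_pos,
    norm_nonneg (deriv P w)]

theorem two_mul_level_le_norm_deriv_apply (hP : Differentiable ℂ P)
    (hw : w ∈ sublevel (T.apply P) δ') (hd : 2 * δ ≤ ‖deriv P w‖) :
    2 * δ' ≤ ‖deriv (T.apply P) w‖ := by
  refine le_trans ?_ (T.le_norm_deriv_apply hP hw hd)
  nlinarith [T.level_le, T.mesh_pos, T.mesh_le]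

theorem level_mul_norm_deriv_deriv_apply_le (hP : Differentiable ℂ P)
    (hw : w ∈ sublevel (T.apply P) δ') (hd : 2 * δ ≤ ‖deriv P w‖)
    (hdd : δ * ‖deriv (deriv P) w‖ ≤ ‖deriv P w‖ ^ 2) :
    δ' * ‖deriv (deriv (T.apply P)) w‖ ≤ ‖deriv (T.apply P) w‖ ^ 2 := by
  have hmesh := T.mesh_pos
  have hsecond : ‖deriv (deriv (T.apply P)) w‖ ≤ 10 / 3 * ‖deriv P w‖ ^ 2 :=
    calc ‖deriv (deriv (T.apply P)) w‖
        ≤ 2 * (‖deriv P w‖ ^ 2 + ‖P w - T.center‖ * ‖deriv (deriv P) w‖) := by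
          rw [T.deriv_deriv_apply hP, norm_mul, Complex.norm_two, ← norm_pow, ← norm_mul]
          gcongr
          exact norm_add_le _ _
      _ ≤ 2 * (‖deriv P w‖ ^ 2 + 2 / 3 * δ * ‖deriv (deriv P) w‖) := by
          gcongr
          exact (T.norm_sub_center_le hw).trans (by linarith [T.mesh_le])
      _ ≤ 10 / 3 * ‖deriv P w‖ ^ 2 := by linarith
  calc δ' * ‖deriv (deriv (T.apply P)) w‖
      ≤ T.mesh ^ 2 / 40 * (10 / 3 * ‖deriv P w‖ ^ 2) := by
        gcongr
        exact T.level_le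
    _ ≤ (3 / 10 * (T.mesh * ‖deriv P w‖)) ^ 2 := by
        linarith [sq_nonneg (T.mesh * ‖deriv P w‖), mul_pow T.mesh ‖deriv P w‖ 2]
    _ ≤ ‖deriv (T.apply P) w‖ ^ 2 := by
        gcongr
        exact T.le_norm_deriv_apply hP hw hd

theorem apply_sub_apply (P : ℂ → ℂ) (x y : ℂ) :
    T.apply P x - T.apply P y =
      ((P x - T.center) + (P y - T.center)) * (P x - P y) - T.eps * T.slope * (x - y) := by
  simp only [apply]
  ring

theorem two_mul_level_mul_norm_sub_le (hP : Continuous P) {S : Set ℂ} (hS : IsPreconnected S)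
    (hSX : S ⊆ sublevel (T.apply P) δ') {x y : ℂ} (hx : x ∈ S) (hy : y ∈ S)
    (hxy : 2 * δ * ‖x - y‖ ≤ ‖P x - P y‖) :
    2 * δ' * ‖x - y‖ ≤ ‖T.apply P x - T.apply P y‖ := by
  have hmesh := T.mesh_pos
  have hproduct : 16 / 25 * T.mesh ^ 2 * ‖x - y‖ ≤
      ‖((P x - T.center) + (P y - T.center)) * (P x - P y)‖ :=
    calc 16 / 25 * T.mesh ^ 2 * ‖x - y‖ = 8 / 25 * T.mesh * (2 * T.mesh * ‖x - y‖) := by ring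
      _ ≤ 8 / 25 * T.mesh * (2 * δ * ‖x - y‖) := by
          gcongr
          exact T.mesh_le
      _ ≤ ‖((P x - T.center) + (P y - T.center)) * (P x - P y)‖ := by
          have hδ := hmesh.trans_le T.mesh_le
          rw [norm_mul]
          exact mul_le_mul (T.mul_mesh_le_norm_add hS hP hSX hx hy) hxy (by positivity)
            (norm_nonneg _)
  have hslope : ‖(T.eps : ℂ) * T.slope * (x - y)‖ ≤ T.mesh ^ 2 / 100 * ‖x - y‖ := by
    rw [norm_mul]
    gcongr
    exact T.norm_eps_mul_slope_le
  have hlevel : δ' * ‖x - y‖ ≤ T.mesh ^ 2 / 40 * ‖x - y‖ := by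
    gcongr
    exact T.level_le
  rw [T.apply_sub_apply]
  refine le_trans ?_ (norm_sub_norm_le _ _)
  linarith [mul_nonneg (sq_nonneg T.mesh) (norm_nonneg (x - y))]

end QuadraticStep

/-- `IsQuadraticTower n P δ ℓ`: the function `P` is obtained from `w ↦ w` by `n` steps, `δ` is the
level reached, and `ℓ`, equal to `δ_n M_n / R_n` in the construction, is the expected size of the
derivative of `P` on `sublevel P δ`. -/
inductive IsQuadraticTower : ℕ → (ℂ → ℂ) → ℝ → ℝ → Prop
  | zero : IsQuadraticTower 0 id (1 / 2) (1 / 2)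
  | succ {n : ℕ} {P : ℂ → ℂ} {δ δ' ℓ : ℝ} (T : QuadraticStep δ δ')
      (hP : IsQuadraticTower n P δ ℓ) :
      IsQuadraticTower (n + 1) (T.apply P) δ' (T.mesh / 4 * ℓ)

namespace IsQuadraticTower

variable {n : ℕ} {P : ℂ → ℂ} {δ ℓ : ℝ} {w : ℂ} {Δ : Set ℂ}

theorem differentiable (hP : IsQuadraticTower n P δ ℓ) : Differentiable ℂ P := by
  induction hP with
  | zero => exact differentiable_id
  | succ T _ ih => exact T.differentiable_apply ih

theorem level_pos (hP : IsQuadraticTower n P δ ℓ) : 0 < δ := by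
  cases hP with
  | zero => exact one_half_pos
  | succ T _ => exact T.level_pos

theorem size_pos (hP : IsQuadraticTower n P δ ℓ) : 0 < ℓ := by
  induction hP with
  | zero => exact one_half_pos
  | succ T _ ih => exact mul_pos (div_pos T.mesh_pos four_pos) ih

theorem sublevel_subset_ball (hP : IsQuadraticTower n P δ ℓ) :
    sublevel P δ ⊆ ball 0 (1 / 2) := by
  induction hP with
  | zero => exact inter_subset_right
  | succ T _ ih => exact (T.sublevel_apply_subset _).trans ih

theorem two_mul_level_le_norm_deriv (hP : IsQuadraticTower n P δ ℓ) (hw : w ∈ sublevel P δ) :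
    2 * δ ≤ ‖deriv P w‖ := by
  induction hP with
  | zero => simp
  | succ T hP ih =>
    exact T.two_mul_level_le_norm_deriv_apply hP.differentiable hw
      (ih (T.sublevel_apply_subset _ hw))

theorem deriv_ne_zero (hP : IsQuadraticTower n P δ ℓ) (hw : w ∈ sublevel P δ) :
    deriv P w ≠ 0 :=
  norm_pos_iff.1 ((mul_pos two_pos hP.level_pos).trans_le (hP.two_mul_level_le_norm_deriv hw))

theorem size_le_norm_deriv (hP : IsQuadraticTower n P δ ℓ) (hw : w ∈ sublevel P δ) :
    ℓ ≤ ‖deriv P w‖ := by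
  induction hP with
  | zero => norm_num
  | succ T hP ih =>
    have hw' := T.sublevel_apply_subset _ hw
    have hderiv := T.le_norm_deriv_apply hP.differentiable hw (hP.two_mul_level_le_norm_deriv hw')
    nlinarith [ih hw', T.mesh_pos, hP.size_pos]

theorem norm_deriv_le_size (hP : IsQuadraticTower n P δ ℓ) (hw : w ∈ sublevel P δ) :
    ‖deriv P w‖ ≤ 2 * 6 ^ n * ℓ := by
  induction hP with
  | zero => norm_num
  | @succ n P δ δ' ℓ T hP ih =>
    have hw' := T.sublevel_apply_subset _ hw
    have hmesh := T.mesh_pos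
    calc ‖deriv (T.apply P) w‖ ≤ 3 / 2 * (T.mesh * ‖deriv P w‖) :=
          T.norm_deriv_apply_le hP.differentiable hw (hP.two_mul_level_le_norm_deriv hw')
      _ ≤ 3 / 2 * (T.mesh * (2 * 6 ^ n * ℓ)) := by
          gcongr
          exact ih hw'
      _ = 2 * 6 ^ (n + 1) * (T.mesh / 4 * ℓ) := by ring

theorem approx_norm_deriv (hP : IsQuadraticTower n P δ ℓ) (hw : w ∈ sublevel P δ) :
    Approx 12 n ℓ ‖deriv P w‖ := by
  have happrox := Approx.of_le one_le_two (by norm_num) hP.size_pos.le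
    (hP.size_le_norm_deriv hw) (hP.norm_deriv_le_size hw)
  rwa [show (2 * 6 : ℝ) = 12 by norm_num] at happrox

theorem level_mul_norm_deriv_deriv_le (hP : IsQuadraticTower n P δ ℓ) (hw : w ∈ sublevel P δ) :
    δ * ‖deriv (deriv P) w‖ ≤ ‖deriv P w‖ ^ 2 := by
  induction hP with
  | zero => simp
  | succ T hP ih =>
    have hw' := T.sublevel_apply_subset _ hw
    exact T.level_mul_norm_deriv_deriv_apply_le hP.differentiable hw
      (hP.two_mul_level_le_norm_deriv hw') (ih hw')

theorem two_mul_level_mul_norm_sub_le (hP : IsQuadraticTower n P δ ℓ) (hΔ : IsPreconnected Δ)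
    (hΔX : Δ ⊆ sublevel P δ) {x y : ℂ} (hx : x ∈ Δ) (hy : y ∈ Δ) :
    2 * δ * ‖x - y‖ ≤ ‖P x - P y‖ := by
  induction hP with
  | zero => simp
  | succ T hP ih =>
    exact T.two_mul_level_mul_norm_sub_le hP.differentiable.continuous hΔ hΔX hx hy
      (ih (hΔX.trans (T.sublevel_apply_subset _)))

theorem isOpen_component (hP : IsQuadraticTower n P δ ℓ) (hΔ : IsComponent Δ (sublevel P δ)) :
    IsOpen Δ :=
  hΔ.isOpen (isOpen_sublevel hP.differentiable.continuous δ)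

theorem injOn (hP : IsQuadraticTower n P δ ℓ) (hΔ : IsComponent Δ (sublevel P δ)) :
    InjOn P Δ := by
  intro x hx y hy hxy
  have hexpand := hP.two_mul_level_mul_norm_sub_le hΔ.isPreconnected hΔ.subset hx hy
  rw [hxy, sub_self, norm_zero] at hexpand
  exact sub_eq_zero.1 (norm_le_zero_iff.1
    (nonpos_of_mul_nonpos_right hexpand (mul_pos two_pos hP.level_pos)))

theorem surjOn (hP : IsQuadraticTower n P δ ℓ) (hΔ : IsComponent Δ (sublevel P δ)) :
    SurjOn P Δ (ball 0 δ) := by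
  have hclosure : closure Δ ⊆ closedBall 0 (1 / 2) :=
    closure_minimal ((hΔ.subset.trans hP.sublevel_subset_ball).trans ball_subset_closedBall)
      isClosed_closedBall
  refine surjOn_of_closure_inter_preimage_subset hΔ.nonempty
    ((isCompact_closedBall 0 (1 / 2)).of_isClosed_subset isClosed_closure hclosure)
    hP.differentiable.continuous.continuousOn (fun w hw => (hΔ.subset hw).2)
    (isOpen_image_of_deriv_ne_zero (hP.isOpen_component hΔ) hP.differentiable.differentiableOn
      fun w hw => hP.deriv_ne_zero (hΔ.subset hw))
    (convex_ball 0 δ).isPreconnected fun w hw => hΔ.closure_inter_subset ⟨hw.1, ?_, hw.2⟩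
  exact closedBall_subset_ball one_half_lt_one (hclosure hw.1)

theorem isUnivalentOnto (hP : IsQuadraticTower n P δ ℓ) (hΔ : IsComponent Δ (sublevel P δ)) :
    IsUnivalentOnto P Δ (ball 0 δ) :=
  ⟨hP.differentiable.differentiableOn, fun _ hw => (hΔ.subset hw).2, hP.injOn hΔ, hP.surjOn hΔ⟩

theorem distortion_le (hP : IsQuadraticTower n P δ ℓ) (hΔ : IsComponent Δ (sublevel P δ)) :
    distortion P Δ ≤ ENNReal.ofReal (Real.exp 2) :=
  (hP.isUnivalentOnto hΔ).distortion_le (hP.isOpen_component hΔ)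
    (fun _ hw => hP.deriv_ne_zero (hΔ.subset hw))
    fun _ hw => hP.level_mul_norm_deriv_deriv_le (hΔ.subset hw)

end IsQuadraticTower

theorem IsVerticalSlice.lt_norm {γ z₀ : ℂ} (h : IsVerticalSlice γ z₀) : 3 / 8 < ‖z₀‖ := by
  simpa using (h.2 0 (mem_ball_self one_pos)).1

theorem IsVerticalSlice.norm_lt {γ z₀ : ℂ} (h : IsVerticalSlice γ z₀) : ‖z₀‖ < 1 / 2 := by
  simpa using (h.2 0 (mem_ball_self one_pos)).2

namespace Param

variable (W : Param) {γ z₀ : ℂ} {n : ℕ}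

theorem cast_m_pos (n : ℕ) : (0 : ℝ) < W.m (n + 1) :=
  Nat.cast_pos.2 (W.m_pos (n + 1) (by omega))

theorem r_succ_pos (n : ℕ) : 0 < W.r (n + 1) :=
  W.r_pos (n + 1) (by omega)

theorem delta_pos : ∀ n, 0 < W.delta n
  | 0 => one_half_pos
  | n + 1 => by
    have hδ := delta_pos n
    have hr := W.r_succ_pos n
    have hm := W.cast_m_pos n
    rw [delta]
    positivity

theorem delta_succ (n : ℕ) :
    W.delta (n + 1) = (W.delta n / W.m (n + 1)) ^ 2 * (W.r (n + 1) / 4) := by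
  rw [delta, div_pow]
  ring

/-- The passage from `P_{n,s}` to `P_{n+1,(s,σ)}` on the slice `z + γ w = z₀`. -/
noncomputable def step (h : IsVerticalSlice γ z₀) (n : ℕ) (σ : W.centers n) :
    QuadraticStep (W.delta n) (W.delta (n + 1)) where
  mesh := W.delta n / W.m (n + 1)
  center := σ
  offset := z₀ - W.a (n + 1)
  slope := if Odd (n + 1) then -γ else 1 / 100 - γ
  mesh_pos := div_pos (W.delta_pos n) (W.cast_m_pos n)
  norm_center_le := by
    have hσ := mem_closedBall_zero_iff.1 σ.2.1
    rwa [mul_sub, mul_one, mul_one_div] at hσ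
  level_pos := W.delta_pos (n + 1)
  level_le := by
    rw [delta_succ]
    nlinarith [W.r_le (n + 1) (by omega), sq_nonneg (W.delta n / W.m (n + 1))]
  le_norm_offset := by
    have ha := mem_ball_zero_iff.1 (W.a_mem (n + 1) (by omega))
    linarith [norm_sub_norm_le z₀ (W.a (n + 1)), h.lt_norm]
  norm_offset_le := by
    have ha := mem_ball_zero_iff.1 (W.a_mem (n + 1) (by omega))
    linarith [norm_sub_le z₀ (W.a (n + 1)), h.norm_lt]
  norm_slope_le := by
    have hγ := h.1
    split_ifs
    · rw [norm_neg]
      linarith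
    · have hsub := norm_sub_le (1 / 100 : ℂ) γ
      norm_num at hsub
      linarith

theorem sliceP_succ (h : IsVerticalSlice γ z₀) (s : W.S n) (σ : W.centers n) :
    W.sliceP γ z₀ (n + 1) (s, σ) = (W.step h n σ).apply (W.sliceP γ z₀ n s) := by
  funext w
  have heps : (W.step h n σ).eps = W.eps (n + 1) := by
    simp only [QuadraticStep.eps, step, eps]
    ring
  have hA : W.A (n + 1) (z₀ - γ * w) w =
      (W.step h n σ).offset + (W.step h n σ).slope * w := by
    simp only [A, step]
    split_ifs <;> ring
  rw [QuadraticStep.apply, heps, ← hA]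
  rfl

theorem delta_mul_M_div_R_succ (n : ℕ) :
    W.delta (n + 1) * W.M (n + 1) / W.R (n + 1) =
      W.delta n / W.m (n + 1) / 4 * (W.delta n * W.M n / W.R n) := by
  have hr := (W.r_succ_pos n).ne'
  have hm := (W.cast_m_pos n).ne'
  rw [delta_succ, M, R, Finset.prod_Icc_succ_top (by omega), Finset.prod_Icc_succ_top (by omega),
    ← M, ← R]
  field_simp

theorem isQuadraticTower_sliceP (h : IsVerticalSlice γ z₀) :
    ∀ (n : ℕ) (s : W.S n),
      IsQuadraticTower n (W.sliceP γ z₀ n s) (W.delta n) (W.delta n * W.M n / W.R n)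
  | 0, s => by
    have hid : W.sliceP γ z₀ 0 s = id := rfl
    simpa [hid, M, R, delta] using IsQuadraticTower.zero
  | n + 1, (s, σ) => by
    rw [sliceP_succ W h, delta_mul_M_div_R_succ]
    exact .succ (W.step h n σ) (isQuadraticTower_sliceP h n s)

theorem sliceX_eq_sublevel (h : IsVerticalSlice γ z₀) (s : W.S n) :
    W.sliceX γ z₀ n s = sublevel (W.sliceP γ z₀ n s) (W.delta n) := by
  ext w
  simp only [sliceX, X, mem_ofPred_eq, mem_prod, mem_sublevel, mem_ball_zero_iff]
  exact and_congr_left' ⟨fun hw => hw.2, fun hw => ⟨(h.2 w (mem_ball_zero_iff.2 hw)).2, hw⟩⟩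

theorem delta_div_delta_mul_M_div_R (n : ℕ) :
    W.delta n / (W.delta n * W.M n / W.R n) = W.R n / W.M n := by
  rw [div_div_eq_mul_div, mul_div_mul_left _ _ (W.delta_pos n).ne']

end Param

end Wermer

open Wermer in
theorem mainTheorem8_general {n : ℕ} {P : ℂ → ℂ} {δ ℓ : ℝ} (hP : IsQuadraticTower n P δ ℓ)
    {Δ : Set ℂ} (hΔ : IsComponent Δ (sublevel P δ)) :
    (∃ p ∈ Δ, ∃ ρ : ℝ, P p = 0 ∧ HasConformalRadius Δ p ρ ∧ Approx 12 n (δ / ℓ) ρ ∧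
      ∃ f : ℂ → ℂ, IsUnivalentOnto f Δ (ball 0 ρ) ∧ f p = 0 ∧ ‖deriv f p‖ = 1 ∧
        distortion f Δ ≤ ENNReal.ofReal (Real.exp 2)) ∧
    IsUnivalentOnto P Δ (ball 0 δ) ∧ distortion P Δ ≤ ENNReal.ofReal (Real.exp 2) ∧
    ∀ w ∈ Δ, Approx 12 n ℓ ‖deriv P w‖ := by
  have huniv := hP.isUnivalentOnto hΔ
  have happrox : ∀ w ∈ Δ, Approx 12 n ℓ ‖deriv P w‖ := fun w hw =>
    hP.approx_norm_deriv (hΔ.subset hw)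
  obtain ⟨p, hp, hPp⟩ := huniv.2.surjOn (mem_ball_self hP.level_pos)
  have hP'p : deriv P p ≠ 0 := hP.deriv_ne_zero (hΔ.subset hp)
  obtain ⟨f, hf, hfp, hf'p, hdist⟩ := huniv.exists_norm_deriv_eq_one hPp hP'p
  exact ⟨⟨p, hp, δ / ‖deriv P p‖, hPp, huniv.hasConformalRadius hP.level_pos hp hPp hP'p,
    (happrox p hp).const_div (by norm_num) hP.size_pos (norm_pos_iff.2 hP'p) hP.level_pos.le,
    f, hf, hfp, hf'p, hdist.trans_le (hP.distortion_le hΔ)⟩,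
    huniv, hP.distortion_le hΔ, happrox⟩

theorem mainTheorem8 :
    ∃ K C : ℝ, 0 < K ∧ 0 < C ∧
      ∀ (W : Wermer.Param) (γ z₀ : ℂ), Wermer.IsVerticalSlice γ z₀ →
      ∀ (n : ℕ) (s : W.S n) (Δ : Set ℂ), Wermer.IsComponent Δ (W.sliceX γ z₀ n s) →
        (∃ p ∈ Δ, ∃ ρ : ℝ,
          W.sliceP γ z₀ n s p = 0 ∧
          Wermer.HasConformalRadius Δ p ρ ∧
          Wermer.Approx C n (W.R n / W.M n) ρ ∧
          ∃ f : ℂ → ℂ, Wermer.IsUnivalentOnto f Δ (Metric.ball 0 ρ) ∧ f p = 0 ∧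
            ‖deriv f p‖ = 1 ∧ Wermer.distortion f Δ ≤ ENNReal.ofReal K) ∧
        Wermer.IsUnivalentOnto (W.sliceP γ z₀ n s) Δ (Metric.ball 0 (W.delta n)) ∧
        Wermer.distortion (W.sliceP γ z₀ n s) Δ ≤ ENNReal.ofReal K ∧
        ∀ w ∈ Δ, Wermer.Approx C n (W.delta n * W.M n / W.R n) ‖deriv (W.sliceP γ z₀ n s) w‖ := by
  refine ⟨Real.exp 2, 12, Real.exp_pos 2, by norm_num, fun W γ z₀ h n s Δ hΔ => ?_⟩
  rw [W.sliceX_eq_sublevel h] at hΔ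
  simpa only [W.delta_div_delta_mul_M_div_R] using
    mainTheorem8_general (W.isQuadraticTower_sliceP h n s) hΔ
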